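/- Conventions. A pregeometry $\mathcal G=(X,*,\mathrm{typ})$ over $I$ is a set $X$ with a reflexive symmetric incidence relation $*$ and a surjection $\mathrm{typ}:X\to I$ such that $x*y$ and $\mathrm{typ}(x)=\mathrm{typ}(y)$ imply $x=y$. Its rank is $|I|$. A flag is a set of pairwise incident elements; a chamber is a flag of type $I$; $\mathcal G$ is a geometry if every flag lies in a chamber. A hall is a subset $W\subseteq X$ with $\mathrm{typ}(W)=I$ such that every $V\subseteq W$ on which $\mathrm{typ}$ is injective is a flag. The residue $\mathcal G_F$ of a flag $F$ is the pregeometry of all elements $x$ with $\mathrm{typ}(x)\notin\mathrm{typ}(F)$ such that $F\cup\{x\}$ is a flag, over the set of types of these elements. A pregeometry is simply connected if any two of its elements are joined by a path $(x_0,\dots,x_m)$, $x_i*x_{i+1}$, and every closed path can be transformed into a trivial one by inserting and deleting cycles of length $1$, $2$ and $3$. (The empty pregeometry counts as simply connected.) The universal completion $\mathcal U(\mathcal A)$ of an amalgam of groups $\mathcal A$, that is, a family of groups with injective homomorphisms (identifications) between some of them, is the group generated by symbols $u_g$, for $g$ in the disjoint union of the groups, with relations $u_gu_h=u_{gh}$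 for $g,h$ in the same group and $u_g=u_{\varphi(g)}$ for every identification $\varphi$ defined at $g$. Corollary 3.4. Let $\mathcal G=(X,*,\mathrm{typ})$ be a geometry over a finite set $I$ and let $G$ be a group of automorphisms of $\mathcal G$ (type-preserving permutations of $X$ preserving incidence in both directions). For each $i\in I$ let $w^i_1,\dots,w^i_{t_i}$ be representatives of the $G$-orbits on the elements of type $i$, one for each orbit, such that (i) $W:=\bigcup_{i\in I}\{w^i_1,\dots,w^i_{t_i}\}$ is a hall, and (ii) for every flag $V\subseteq W$, the action of $G$ on the pregeometry over $\mathrm{typ}(V)$ consisting of all elements of the orbits $G.x$, $x\in V$, is flag-transitive: any two flags of it of the same type are mapped onto each other by an element of $G$. For a flag $U\subseteq W$ let $G_U$ be the stabilizer of $U$ in $G$. Let $\mathcal A(\mathcal G,G,W)$ be the amalgam formed by all $G_U$, $U\subseteq W$ a nonempty flag, with the inclusion maps as identifications. For a natural number $k\le|I|$ let $\mathcal A_{(k)}(\mathcal G,G,W)$ be the subamalgam of those $G_U$ of rank $|I\setminus\mathrm{typ}(U)|\le k$. Assume that for every flag $U\subseteq W$ (including $U=\emptyset$, where $\mathcal G_\emptyset=\mathcal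 G$) whose residue $\mathcal G_U$ has rank at least $k$, this residue is simply connected. Then $$G=\mathcal U(\mathcal A(\mathcal G,G,W))=\mathcal U(\mathcal A_{(k)}(\mathcal G,G,W)),$$ that is, the canonical homomorphisms $\mathcal U(\mathcal A(\mathcal G,G,W))\to G$, $\mathcal U(\mathcal A_{(k)}(\mathcal G,G,W))\to G$ and $\mathcal U(\mathcal A_{(k)}(\mathcal G,G,W))\to\mathcal U(\mathcal A(\mathcal G,G,W))$ are isomorphisms. -/

import Mathlib

universe u v

/-- A pregeometry over the type set `I` with element set `X`. -/
structure Pregeometry (X : Type u) (I : Type v) where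
  /-- the incidence relation -/
  inc : X → X → Prop
  inc_refl : ∀ x, inc x x
  inc_symm : ∀ x y, inc x y → inc y x
  /-- the type function -/
  typ : X → I
  typ_surjective : Function.Surjective typ
  eq_of_inc : ∀ x y, inc x y → typ x = typ y → x = y

namespace Pregeometry

variable {X : Type u} {I : Type v} (Γ : Pregeometry X I)

/-- A flag is a set of pairwise incident elements. -/
def IsFlag (F : Set X) : Prop := ∀ x ∈ F, ∀ y ∈ F, Γ.inc x y

/-- A chamber is a flag of type `I`. -/
def IsChamber (C : Set X) : Prop := Γ.IsFlag C ∧ Γ.typ '' C = Set.univ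

/-- A geometry is a pregeometry in which every flag is contained in a chamber. -/
def IsGeometry : Prop := ∀ F, Γ.IsFlag F → ∃ C, Γ.IsChamber C ∧ F ⊆ C

/-- The rank of a pregeometry is the cardinality of its type set. -/
noncomputable def rank (_Γ : Pregeometry X I) : ℕ := Nat.card I

/-- A lounge is a set of elements every subset of which on which `typ` is injective is a flag. -/
def IsLounge (W : Set X) : Prop := ∀ V ⊆ W, Set.InjOn Γ.typ V → Γ.IsFlag V

/-- A hall is a lounge containing elements of all types. -/
def IsHall (W : Set X) : Prop := Γ.IsLounge W ∧ Γ.typ '' W = Set.univ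

/-! ### Residues -/

/-- The type set of the residue of `F`. -/
def residueTypes (F : Set X) : Set I :=
  {j | j ∉ Γ.typ '' F ∧ ∃ x, Γ.typ x = j ∧ Γ.IsFlag (F ∪ {x})}

/-- The element set of the residue of `F`. -/
def residueElements (F : Set X) : Set X :=
  {x | Γ.typ x ∈ Γ.residueTypes F ∧ Γ.IsFlag (F ∪ {x})}

/-- The residue of the flag `F`, with the restricted incidence relation and type function. -/
def residue (F : Set X) : Pregeometry (Γ.residueElements F) (Γ.residueTypes F) where
  inc x y := Γ.inc x y
  inc_refl x := Γ.inc_refl x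
  inc_symm x y h := Γ.inc_symm x y h
  typ x := ⟨Γ.typ x, x.2.1⟩
  typ_surjective := by
    rintro ⟨j, hj⟩
    obtain ⟨x, hx, hF⟩ := hj.2
    exact ⟨⟨x, by rw [hx]; exact hj, hF⟩, Subtype.ext hx⟩
  eq_of_inc x y h ht := Subtype.ext (Γ.eq_of_inc x y h (congrArg Subtype.val ht))

/-! ### Paths, homotopy, simple connectivity -/

/-- `l = (x₀, …, xₖ)` is a path with `x₀ = x` and `xₖ = y`. -/
def IsPath (x y : X) (l : List X) : Prop :=
  l.IsChain Γ.inc ∧ l.head? = some x ∧ l.getLast? = some y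

/-- Insertion of a cycle of length one (repetition), two (return) or three (triangle). -/
inductive ElementaryHomotopy : List X → List X → Prop
  | repetition (l₁ l₂ : List X) (x : X) :
      ElementaryHomotopy (l₁ ++ x :: l₂) (l₁ ++ x :: x :: l₂)
  | return (l₁ l₂ : List X) (x y : X) (hxy : Γ.inc x y) :
      ElementaryHomotopy (l₁ ++ x :: l₂) (l₁ ++ x :: y :: x :: l₂)
  | triangle (l₁ l₂ : List X) (x y z : X)
      (hxy : Γ.inc x y) (hyz : Γ.inc y z) (hzx : Γ.inc z x) :
      ElementaryHomotopy (l₁ ++ x :: l₂) (l₁ ++ x :: y :: z :: x :: l₂)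

/-- Homotopy: finitely many elementary homotopies, in either direction. -/
def Homotopic : List X → List X → Prop := Relation.EqvGen Γ.ElementaryHomotopy

/-- Any two elements are joined by a path. (The empty pregeometry, which is the residue of a
chamber, is not excluded.) -/
def IsConnected : Prop := ∀ x y, ∃ l, Γ.IsPath x y l

/-- Connected, and every cycle is null-homotopic, that is, all fundamental groups are trivial. -/
def IsSimplyConnected : Prop :=
  Γ.IsConnected ∧ ∀ x l, Γ.IsPath x x l → Γ.Homotopic l [x]

/-! ### Groups of automorphisms -/

/-- The group of all type preserving permutations of `X` that preserve incidence in both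
directions. -/
def autGroup : Subgroup (Equiv.Perm X) where
  carrier := {σ | (∀ x, Γ.typ (σ x) = Γ.typ x) ∧ ∀ x y, Γ.inc (σ x) (σ y) ↔ Γ.inc x y}
  one_mem' := ⟨fun _ => rfl, fun _ _ => Iff.rfl⟩
  mul_mem' := by
    rintro σ τ ⟨hσ, hσ'⟩ ⟨hτ, hτ'⟩
    exact ⟨fun x => (hσ (τ x)).trans (hτ x), fun x y => (hσ' (τ x) (τ y)).trans (hτ' x y)⟩
  inv_mem' := by
    rintro σ ⟨hσ, hσ'⟩
    refine ⟨fun x => ?_, fun x y => ?_⟩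
    · simpa using (hσ (σ⁻¹ x)).symm
    · simpa using (hσ' (σ⁻¹ x) (σ⁻¹ y)).symm

/-- `W` consists of exactly one representative of each `G`-orbit on `X`. -/
def IsOrbitRepresentatives (G : Subgroup (Equiv.Perm X)) (W : Set X) : Prop :=
  ∀ x, ∃! w, w ∈ W ∧ w ∈ MulAction.orbit G x

/-- The elements of the orbit pregeometry of `V`: all elements of the orbits `G.x`, `x ∈ V`. Its
type set is `typ '' V`, and its incidence relation and type function are those of `Γ`. -/
def orbitElements (G : Subgroup (Equiv.Perm X)) (V : Set X) : Set X :=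
  ⋃ x ∈ V, MulAction.orbit G x

/-- `G` is flag-transitive on the pregeometry induced on the set `Y` of elements, whose flags are
the flags of `Γ` contained in `Y`. -/
def IsFlagTransitiveOn (G : Subgroup (Equiv.Perm X)) (Y : Set X) : Prop :=
  ∀ c d : Set X, c ⊆ Y → d ⊆ Y → Γ.IsFlag c → Γ.IsFlag d → Γ.typ '' c = Γ.typ '' d →
    ∃ σ ∈ G, σ '' c = d

end Pregeometry

/-! ### Amalgams of groups and their universal completions -/

/-- A family of groups with monomorphisms ("identifications") between some of them. The grading of
the family into levels is not recorded, as completions do not depend on it. -/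
structure Amalgam where
  /-- the index set of the family -/
  Index : Type u
  /-- the groups of the family -/
  Grp : Index → Type u
  [group : ∀ a, Group (Grp a)]
  /-- there is an identification from `Grp a` to `Grp b` -/
  Ident : Index → Index → Prop
  /-- the identifications -/
  ident : ∀ {a b}, Ident a b → (Grp a →* Grp b)
  ident_injective : ∀ {a b} (h : Ident a b), Function.Injective (ident h)

namespace Amalgam

attribute [instance] Amalgam.group

variable (A : Amalgam.{u})

/-- The relations `u_x u_y = u_{xy}` for `x`, `y` in the same group of the amalgam, and
`u_x = u_{φ(x)}` for the identifications `φ`. -/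
inductive Rel : FreeGroup (Σ a, A.Grp a) → Prop
  | mul (a : A.Index) (x y : A.Grp a) :
      Rel (FreeGroup.of ⟨a, x⟩ * FreeGroup.of ⟨a, y⟩ * (FreeGroup.of ⟨a, x * y⟩)⁻¹)
  | ident {a b : A.Index} (h : A.Ident a b) (x : A.Grp a) :
      Rel (FreeGroup.of ⟨a, x⟩ * (FreeGroup.of ⟨b, A.ident h x⟩)⁻¹)

/-- The group `U(A)` generated by the disjoint union of the groups of `A` subject to `A.Rel`. -/
abbrev UniversalCompletion : Type u := PresentedGroup {r | A.Rel r}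

/-- The homomorphisms `π a` respect the identifications. -/
def IsCompatible {H : Type u} [Group H] (π : ∀ a, A.Grp a →* H) : Prop :=
  ∀ a b (h : A.Ident a b) (x : A.Grp a), π b (A.ident h x) = π a x

/-- The homomorphism `U(A) → H`, `u_x ↦ π(x)`. -/
def lift {H : Type u} [Group H] (π : ∀ a, A.Grp a →* H) (hπ : A.IsCompatible π) :
    A.UniversalCompletion →* H :=
  PresentedGroup.toGroup (f := fun x : Σ a, A.Grp a => π x.1 x.2) <| by
    intro r hr
    cases hr with
    | mul a x y => simp
    | ident h x => simp [hπ _ _ h x]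

/-- The maps `x ↦ u_x` from the groups of `A` to `U(A)`. -/
def toUniversal (a : A.Index) : A.Grp a →* A.UniversalCompletion :=
  MonoidHom.mk' (fun x => PresentedGroup.of ⟨a, x⟩) fun x y => by
    have h := PresentedGroup.one_of_mem (rels := {r | A.Rel r}) (Rel.mul a x y)
    rw [map_mul, map_mul, map_inv, mul_inv_eq_one] at h
    exact h.symm

theorem toUniversal_compatible : A.IsCompatible A.toUniversal := by
  intro a b h x
  have h' := PresentedGroup.one_of_mem (rels := {r | A.Rel r}) (Rel.ident h x)
  rw [map_mul, map_inv, mul_inv_eq_one] at h'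
  exact h'.symm

end Amalgam

namespace Pregeometry

variable {X : Type u} {I : Type v} (Γ : Pregeometry X I)

/-- The parabolic subgroup `G_U`, the (elementwise) stabilizer of `U` in `G`. -/
def parabolic (G : Subgroup (Equiv.Perm X)) (U : Set X) : Subgroup G := fixingSubgroup G U

/-- For flags, the elementwise and the setwise stabilizer in a group of automorphisms coincide. -/
theorem mem_parabolic_iff (G : Subgroup (Equiv.Perm X)) (hG : G ≤ Γ.autGroup) (U : Set X)
    (hU : Γ.IsFlag U) (g : G) : g ∈ parabolic G U ↔ (g : Equiv.Perm X) '' U = U := by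
  unfold parabolic
  rw [mem_fixingSubgroup_iff]
  constructor
  · intro h
    ext y
    constructor
    · rintro ⟨x, hx, rfl⟩
      have : (g : Equiv.Perm X) x = x := h x hx
      rwa [this]
    · intro hy
      exact ⟨y, hy, h y hy⟩
  · intro h x hx
    have hgx : (g : Equiv.Perm X) x ∈ U := h ▸ Set.mem_image_of_mem _ hx
    exact Γ.eq_of_inc _ _ (hU _ hgx _ hx) ((hG g.2).1 x)

/-- The amalgam on the family `(G_U)`, `U ∈ S`, with the natural inclusions `G_U → G_U'` for
`U' ⊆ U` as identifications. -/
def shapeAmalgam (G : Subgroup (Equiv.Perm X)) (S : Set (Set X)) : Amalgam.{u} where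
  Index := S
  Grp U := parabolic G (U : Set X)
  Ident U U' := (U' : Set X) ⊆ (U : Set X)
  ident h := Subgroup.inclusion (fixingSubgroup_antitone G X h)
  ident_injective h := Subgroup.inclusion_injective (fixingSubgroup_antitone G X h)

/-- The natural homomorphism `U(A) → G` induced by the inclusions `G_U → G`. -/
def shapeToGroup (G : Subgroup (Equiv.Perm X)) (S : Set (Set X)) :
    (shapeAmalgam G S).UniversalCompletion →* G :=
  (shapeAmalgam G S).lift (fun U : S => (parabolic G (U : Set X)).subtype) fun _ _ _ _ => rfl

/-- The natural homomorphism between the universal completions of a subamalgam and an amalgam. -/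
def shapeMap (G : Subgroup (Equiv.Perm X)) {S T : Set (Set X)} (h : S ⊆ T) :
    (shapeAmalgam G S).UniversalCompletion →* (shapeAmalgam G T).UniversalCompletion :=
  (shapeAmalgam G S).lift
    (fun U : S => (shapeAmalgam G T).toUniversal (⟨U, h U.2⟩ : T))
    fun (U U' : S) hU x => (shapeAmalgam G T).toUniversal_compatible
      (⟨U, h U.2⟩ : T) (⟨U', h U'.2⟩ : T) hU x

/-- The nonempty flags in `W`; they index the amalgam `A(Γ, G, W)` of maximal parabolics. -/
def nonemptyFlags (W : Set X) : Set (Set X) := {U | U ⊆ W ∧ Γ.IsFlag U ∧ U.Nonempty}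

/-- The nonempty flags `U` in `W` of corank at most `k`, that is, for which the parabolic `G_U` has
rank at most `k`; they index the amalgam `A₍ₖ₎(Γ, G, W)` of rank `k` parabolics. -/
def nonemptyFlagsOfCorankLE (W : Set X) (k : ℕ) : Set (Set X) :=
  {U | U ∈ Γ.nonemptyFlags W ∧ (Γ.typ '' U)ᶜ.ncard ≤ k}

theorem nonemptyFlagsOfCorankLE_subset (W : Set X) (k : ℕ) :
    Γ.nonemptyFlagsOfCorankLE W k ⊆ Γ.nonemptyFlags W := fun _ h => h.1

end Pregeometry

/-! The inverse of the canonical map to `G` comes from a Tits-type extension argument. The hall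
condition and flag-transitivity let every flag be moved into `W` (`exists_smul_mem_of_isFlag`), so
`W` meets the residue of a flag `U ⊆ W` in a strict fundamental domain for `G_U`, where the
stabilizer of `w` is `G_{U ∪ {w}}`. Connectedness makes these stabilizers generate `G_U`
(`mem_of_stabilizer_le`). Simple connectedness makes compatible homomorphisms on them extend
(`exists_extension`): they define a cocycle on incident pairs, which has trivial holonomy around
closed paths and hence is a coboundary (`exists_trivialization`).

Induction on the corank carries both statements from the rank `k` parabolics up to `G_∅ = G`; the
extension with values in the universal completion inverts the map to `G`. The full amalgam is the
case `k = |I|`, and the third isomorphism follows by two out of three. -/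

theorem Amalgam.lift_toUniversal (A : Amalgam.{u}) {H : Type u} [Group H]
    (π : ∀ a, A.Grp a →* H) (hπ : A.IsCompatible π) (a : A.Index) (x : A.Grp a) :
    A.lift π hπ (A.toUniversal a x) = π a x := by
  unfold lift toUniversal
  exact PresentedGroup.toGroup.of _

namespace Pregeometry

/-! ### Holonomy and cocycles on simply connected pregeometries -/

section SimplyConnected

variable {X : Type*} {I : Type*} {Γ : Pregeometry X I}

theorem IsFlag.subset {F F' : Set X} (h : Γ.IsFlag F) (hF : F' ⊆ F) : Γ.IsFlag F' :=
  fun x hx y hy => h x (hF hx) y (hF hy)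

/-- A function that is constant along edges is constant along paths. -/
theorem IsPath.eq_of_inc {α : Type*} {A : X → α} (hA : ∀ x y, Γ.inc x y → A x = A y) :
    ∀ {l : List X} {x y : X}, Γ.IsPath x y l → A x = A y
  | [], _, _, h => by simp [IsPath] at h
  | [z], x, y, h => by
    obtain ⟨-, h1, h2⟩ := h
    simp at h1 h2
    rw [← h1, ← h2]
  | z :: w :: l, x, y, h => by
    obtain ⟨h0, h1, h2⟩ := h
    rw [List.isChain_cons_cons] at h0
    have hz : z = x := by simpa using h1
    rw [← hz, hA z w h0.1]
    exact IsPath.eq_of_inc hA (l := w :: l) ⟨h0.2, by simp, by simpa using h2⟩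

theorem IsConnected.eq_of_inc (h : Γ.IsConnected) {α : Type*} {A : X → α}
    (hA : ∀ x y, Γ.inc x y → A x = A y) (x y : X) : A x = A y :=
  (h x y).elim fun _ hl => hl.eq_of_inc hA

/-- The holonomy of a transition function along a list of elements. -/
def holonomy {H : Type*} [Group H] (c : X → X → H) : List X → H
  | [] => 1
  | [_] => 1
  | x :: y :: l => holonomy c (y :: l) * c y x

section Holonomy

variable {H : Type*} [Group H] (c : X → X → H)

theorem holonomy_append : ∀ (l₁ : List X) (x : X) (l₂ : List X),
    holonomy c (l₁ ++ x :: l₂) = holonomy c (x :: l₂) * holonomy c (l₁ ++ [x])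
  | [], x, l₂ => by simp [holonomy]
  | [y], x, l₂ => by simp [holonomy]
  | y :: z :: l, x, l₂ => by
    have := holonomy_append (z :: l) x l₂
    simp only [List.cons_append, holonomy] at this ⊢
    rw [this, mul_assoc]

variable {c}

/-- Degenerate triangles in the cocycle condition give `c x x = 1` and `c x y * c y x = 1`, so each
inserted cycle contributes the factor 1. -/
theorem ElementaryHomotopy.holonomy_eq
    (hc : ∀ x y z, Γ.inc x y → Γ.inc y z → Γ.inc z x → c z y * c y x = c z x)
    {l l' : List X} (h : Γ.ElementaryHomotopy l l') : holonomy c l = holonomy c l' := by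
  have h1 : ∀ x, c x x = 1 := fun x => by
    have := hc x x x (Γ.inc_refl x) (Γ.inc_refl x) (Γ.inc_refl x)
    simpa using this
  have h2 : ∀ x y, Γ.inc x y → c x y * c y x = 1 := fun x y hxy => by
    rw [hc x y x hxy (Γ.inc_symm _ _ hxy) (Γ.inc_refl x), h1]
  rcases h with ⟨l₁, l₂, x⟩ | ⟨l₁, l₂, x, y, hxy⟩ | ⟨l₁, l₂, x, y, z, hxy, hyz, hzx⟩
  · rw [holonomy_append, holonomy_append c l₁ x (x :: l₂), holonomy, h1, mul_one]
  · rw [holonomy_append, holonomy_append c l₁ x (y :: x :: l₂), holonomy, holonomy, mul_assoc,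
      mul_assoc, ← mul_assoc (c x y), h2 x y hxy, one_mul]
  · rw [holonomy_append, holonomy_append c l₁ x (y :: z :: x :: l₂), holonomy, holonomy, holonomy,
      mul_assoc (_ * _) (c z y), hc x y z hxy hyz hzx, mul_assoc (holonomy c (x :: l₂)),
      h2 x z (Γ.inc_symm _ _ hzx), mul_one]

theorem Homotopic.holonomy_eq
    (hc : ∀ x y z, Γ.inc x y → Γ.inc y z → Γ.inc z x → c z y * c y x = c z x)
    {l l' : List X} (h : Γ.Homotopic l l') : holonomy c l = holonomy c l' := by
  induction h with
  | rel _ _ h => exact ElementaryHomotopy.holonomy_eq hc h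
  | refl => rfl
  | symm _ _ _ ih => exact ih.symm
  | trans _ _ _ _ _ ih₁ ih₂ => exact ih₁.trans ih₂

theorem IsPath.exists_append {x y : X} {l : List X} (h : Γ.IsPath x y l) :
    ∃ l', l = l' ++ [y] :=
  ⟨l.dropLast, (List.dropLast_append_getLast? y (by simpa using h.2.2)).symm⟩

theorem IsPath.exists_cons {x y : X} {l : List X} (h : Γ.IsPath x y l) :
    ∃ l', l = x :: l' := by
  obtain ⟨-, h, -⟩ := h
  cases l with
  | nil => simp at h
  | cons a l => exact ⟨l, by simp at h; rw [h]⟩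

/-- On a simply connected pregeometry every flat transition function is a coboundary. -/
theorem IsSimplyConnected.exists_trivialization (h : Γ.IsSimplyConnected)
    (hc : ∀ x y z, Γ.inc x y → Γ.inc y z → Γ.inc z x → c z y * c y x = c z x) :
    ∃ b : X → H, ∀ x y, Γ.inc x y → c y x = b y * (b x)⁻¹ := by
  rcases isEmpty_or_nonempty X with hX | ⟨⟨x₀⟩⟩
  · exact ⟨fun _ => 1, fun x => (hX.false x).elim⟩
  choose p hp using h.1 x₀
  choose q hq using fun x => h.1 x x₀
  -- The closed path from `x₀` to `x`, across the edge to `y` and back to `x₀` is null-homotopic.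
  have key : ∀ x y, Γ.inc x y →
      holonomy c (q y) * c y x * holonomy c (p x) = 1 := by
    intro x y hxy
    obtain ⟨p', hp'⟩ := (hp x).exists_append
    obtain ⟨q', hq'⟩ := (hq y).exists_cons
    have h0 : Γ.IsPath x₀ x₀ (p x ++ q y) := by
      refine ⟨List.IsChain.append (hp x).1 (hq y).1 ?_, ?_, ?_⟩
      · intro a ha b hb
        rw [(hp x).2.2] at ha
        rw [(hq y).2.1] at hb
        simp only [Option.mem_def, Option.some.injEq] at ha hb
        rwa [← ha, ← hb]
      · rw [List.head?_append, (hp x).2.1]; rfl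
      · rw [List.getLast?_append, (hq y).2.2]; rfl
    have h1 := Homotopic.holonomy_eq hc (h.2 x₀ _ h0)
    rw [hp', hq', List.append_assoc, List.singleton_append, holonomy_append] at h1
    rw [hp', hq']
    exact h1
  have h1 : ∀ x, c x x = 1 := fun x => by
    simpa using hc x x x (Γ.inc_refl x) (Γ.inc_refl x) (Γ.inc_refl x)
  refine ⟨fun x => holonomy c (p x), fun x y hxy => ?_⟩
  have e1 := key x y hxy
  -- The degenerate edge shows that the way back from `y` has holonomy inverse to the way out.
  have e2 := key y y (Γ.inc_refl y)
  rw [h1, mul_one, mul_eq_one_iff_eq_inv] at e2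
  rw [e2, mul_eq_one_iff_eq_inv, inv_mul_eq_iff_eq_mul] at e1
  exact e1

end Holonomy

end SimplyConnected

/-! ### Generation and extension from a strict fundamental domain -/

section FundamentalDomain

variable {X : Type*} {I : Type*} {G : Type*} [Group G] [MulAction G X]

/-- `W` is a strict fundamental domain for the action of `G` on the flags of rank at most three. -/
structure IsFundamentalDomain (Γ : Pregeometry X I) (G : Type*) [Group G] [MulAction G X]
    (W : Set X) : Prop where
  inc_smul : ∀ (g : G) x y, Γ.inc x y → Γ.inc (g • x) (g • y)
  eq_of_smul : ∀ w ∈ W, ∀ g : G, g • w ∈ W → g • w = w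
  exists_smul_mem : ∀ x y z, Γ.inc x y → Γ.inc y z → Γ.inc z x →
    ∃ g : G, g • x ∈ W ∧ g • y ∈ W ∧ g • z ∈ W

namespace IsFundamentalDomain

variable {Γ : Pregeometry X I} {W : Set X}


theorem exists_smul_mem_pair (h : Γ.IsFundamentalDomain G W) {x y : X} (hxy : Γ.inc x y) :
    ∃ g : G, g • x ∈ W ∧ g • y ∈ W := by
  obtain ⟨g, hx, hy, -⟩ :=
    h.exists_smul_mem x y y hxy (Γ.inc_refl y) (Γ.inc_symm _ _ hxy)
  exact ⟨g, hx, hy⟩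

theorem exists_smul_mem_single (h : Γ.IsFundamentalDomain G W) (x : X) : ∃ g : G, g • x ∈ W :=
  (h.exists_smul_mem_pair (Γ.inc_refl x)).imp fun _ hg => hg.1

theorem smul_eq_smul (h : Γ.IsFundamentalDomain G W) {x : X} {g g' : G}
    (hg : g • x ∈ W) (hg' : g' • x ∈ W) :
    g • x = g' • x := by
  have := h.eq_of_smul _ hg' (g * g'⁻¹) (by simpa [mul_smul] using hg)
  simpa [mul_smul] using this

theorem stabilizes (h : Γ.IsFundamentalDomain G W) {x : X} {g g' : G}
    (hg : g • x ∈ W) (hg' : g' • x ∈ W) :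
    (g' * g⁻¹) • (g • x) = g • x := by
  rw [mul_smul, inv_smul_smul, h.smul_eq_smul hg hg']

/-- The stabilizers of the elements of a strict fundamental domain generate the group. -/
theorem mem_of_stabilizer_le (h : Γ.IsFundamentalDomain G W)
    (hconn : Γ.IsConnected) [Nonempty X] {K : Subgroup G}
    (hK : ∀ w ∈ W, ∀ g : G, g • w = w → g ∈ K) (g : G) : g ∈ K := by
  choose r hr using h.exists_smul_mem_single
  -- The coset `g⁻¹K` depends only on `x`, since two choices of `g` differ by a stabilizer element.
  -- Incident elements share a choice, so the coset is constant; comparing `w` with `g • w` then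
  -- gives `K = gK`.
  have hA : ∀ x (g : G), g • x ∈ W → (((r x)⁻¹ : G) : G ⧸ K) = (g⁻¹ : G) := fun x g hg => by
    refine QuotientGroup.eq.2 ?_
    rw [inv_inv]
    exact hK _ hg _ (h.stabilizes hg (hr x))
  have hA' : ∀ x y, Γ.inc x y → (((r x)⁻¹ : G) : G ⧸ K) = ((r y)⁻¹ : G) := fun x y hxy => by
    obtain ⟨g, hx, hy⟩ := h.exists_smul_mem_pair hxy
    exact (hA x g hx).trans (hA y g hy).symm
  obtain ⟨x⟩ := ‹Nonempty X›
  have hw := hr x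
  set w := r x • x
  have e := hconn.eq_of_inc (A := fun x => (((r x)⁻¹ : G) : G ⧸ K)) hA' w (g • w)
  rw [hA w 1 (by simpa using hw), hA (g • w) g⁻¹ (by simpa using hw)] at e
  simpa using QuotientGroup.eq.1 e

/-- On a simply connected pregeometry, compatible homomorphisms from the stabilizers of the
elements of a strict fundamental domain extend to the whole group. -/
theorem exists_extension (h : Γ.IsFundamentalDomain G W)
    (hsc : Γ.IsSimplyConnected) [Nonempty X] {H : Type*} [Group H]
    (f : X → G → H)
    (hmul : ∀ w ∈ W, ∀ s t : G, s • w = w → t • w = w → f w (s * t) = f w s * f w t)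
    (hcompat : ∀ w ∈ W, ∀ w' ∈ W, Γ.inc w w' → ∀ s : G, s • w = w → s • w' = w' →
      f w s = f w' s) :
    ∃ φ : G →* H, ∀ w ∈ W, ∀ s : G, s • w = w → φ s = f w s := by
  classical
  choose r hr using h.exists_smul_mem_single
  have hinc : ∀ x y (g : G), g • x ∈ W → g • y ∈ W → Γ.inc x y →
      Γ.inc (r x • x) (r y • y) := fun x y g hx hy hxy => by
    rw [h.smul_eq_smul (hr x) hx, h.smul_eq_smul (hr y) hy]
    exact h.inc_smul g x y hxy
  -- the coordinate of the frame `g⁻¹` over `x`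
  let a : X → G → H := fun x g => f (r x • x) (r x * g⁻¹)
  have ha : ∀ x (g g' : G), g • x ∈ W → g' • x ∈ W →
      a x g' = a x g * f (r x • x) (g * g'⁻¹) := fun x g g' hg hg' => by
    have hg0 := h.smul_eq_smul (hr x) hg
    have hg0' := h.smul_eq_smul (hr x) hg'
    have e1 := h.stabilizes hg (hr x)
    have e2 := h.stabilizes hg' hg
    rw [← hg0] at e1
    rw [← hg0'] at e2
    rw [← hmul _ (hr x) _ _ e1 e2]
    simp [a, mul_assoc]
  -- The change of frame `g * g'⁻¹` stabilizes the representatives of both `x` and `y`, so by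
  -- compatibility its two contributions cancel.
  have hindep : ∀ x y, Γ.inc x y → ∀ g g' : G, g • x ∈ W → g • y ∈ W → g' • x ∈ W →
      g' • y ∈ W → a y g * (a x g)⁻¹ = a y g' * (a x g')⁻¹ := by
    intro x y hxy g g' hx hy hx' hy'
    have e2 := h.stabilizes hx' hx
    rw [← h.smul_eq_smul (hr x) hx'] at e2
    have e3 := h.stabilizes hy' hy
    rw [← h.smul_eq_smul (hr y) hy'] at e3
    rw [ha x g g' hx hx', ha y g g' hy hy',
      hcompat _ (hr x) _ (hr y) (hinc x y g hx hy hxy) _ e2 e3]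
    group
  -- The default 1 is harmless: incident pairs always have a common `g`.
  let c : X → X → H := fun y x =>
    if hg : ∃ g : G, g • x ∈ W ∧ g • y ∈ W then a y hg.choose * (a x hg.choose)⁻¹ else 1
  have hc : ∀ x y, Γ.inc x y → ∀ g : G, g • x ∈ W → g • y ∈ W →
      c y x = a y g * (a x g)⁻¹ := by
    intro x y hxy g hx hy
    have hg : ∃ g : G, g • x ∈ W ∧ g • y ∈ W := ⟨g, hx, hy⟩
    simp only [c, dif_pos hg]
    exact hindep x y hxy _ _ hg.choose_spec.1 hg.choose_spec.2 hx hy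
  -- One `g` moves the whole triangle into `W`; in this common frame the cocycle identity
  -- telescopes.
  obtain ⟨b, hb⟩ := hsc.exists_trivialization (c := c) (by
    intro x y z hxy hyz hzx
    obtain ⟨g, hx, hy, hz⟩ := h.exists_smul_mem x y z hxy hyz hzx
    rw [hc x y hxy g hx hy, hc y z hyz g hy hz, hc x z (Γ.inc_symm _ _ hzx) g hx hz]
    group)
  have hβ : ∀ x y, Γ.inc x y → ∀ g : G, g • x ∈ W → g • y ∈ W →
      (b x)⁻¹ * a x g = (b y)⁻¹ * a y g := by
    intro x y hxy g hx hy
    have := hb x y hxy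
    rw [hc x y hxy g hx hy, mul_inv_eq_iff_eq_mul] at this
    rw [this]
    group
  have hfix : ∀ w ∈ W, r w • w = w := fun w hw => h.eq_of_smul w hw _ (hr w)
  -- the global coordinate of the frame `g`, computed over `g • w`
  let F : X → G → H := fun w g => (b (g • w))⁻¹ * a (g • w) g⁻¹
  have hF : ∀ w ∈ W, ∀ w' ∈ W, ∀ g, F w g = F w' g := by
    intro w hw w' hw' g
    have := hsc.1.eq_of_inc (A := fun x => F (r x • x) g) (by
      intro x y hxy
      obtain ⟨g', hx, hy⟩ := h.exists_smul_mem_pair hxy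
      exact hβ _ _ (h.inc_smul g _ _ (hinc x y g' hx hy hxy)) g⁻¹
        (by simpa using hr x) (by simpa using hr y)) w w'
    simpa only [hfix w hw, hfix w' hw'] using this
  -- Since `s` fixes `w`, the frames `g` and `g * s` lie over the same point `g • w`, and `ha`
  -- compares them.
  have hFs : ∀ w ∈ W, ∀ g s : G, s • w = w → F w (g * s) = F w g * f w s := by
    intro w hw g s hs
    have e : r (g • w) • g • w = w := by
      have := h.smul_eq_smul (hr (g • w)) (g' := g⁻¹) (by simpa using hw)
      simpa using this
    have := ha (g • w) g⁻¹ (s⁻¹ * g⁻¹) (by simpa using hw)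
      (by rw [mul_smul, inv_smul_smul, inv_smul_eq_iff.2 hs.symm]; exact hw)
    simp only [F, mul_smul, hs, mul_inv_rev]
    rw [this, e]
    simp [mul_assoc]
  obtain ⟨x₀⟩ := ‹Nonempty X›
  have hw₀ := hr x₀
  set w₀ := r x₀ • x₀
  let φ : G → H := fun g => (F w₀ 1)⁻¹ * F w₀ g
  have hφs : ∀ w ∈ W, ∀ g s : G, s • w = w → φ (g * s) = φ g * f w s := by
    intro w hw g s hs
    simp only [φ]
    rw [hF w₀ hw₀ w hw (g * s), hFs w hw g s hs, hF w₀ hw₀ w hw g, ← mul_assoc]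
  have hφ1 : φ 1 = 1 := inv_mul_cancel _
  have hφf : ∀ w ∈ W, ∀ s : G, s • w = w → φ s = f w s := fun w hw s hs => by
    simpa [hφ1] using hφs w hw 1 s hs
  -- The right factors for which `φ` is multiplicative form a subgroup; it contains the stabilizers,
  -- which generate `G`.
  let K : Subgroup G :=
    { carrier := {s | ∀ g, φ (g * s) = φ g * φ s}
      one_mem' := fun g => by simp [hφ1]
      mul_mem' := fun {s t} hs ht g => by
        rw [← mul_assoc, ht, hs, ht s, mul_assoc]
      inv_mem' := fun {s} hs g => by
        have e1 := hs s⁻¹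
        have e2 := hs (g * s⁻¹)
        rw [inv_mul_cancel, hφ1] at e1
        rw [inv_mul_cancel_right] at e2
        rw [e2, mul_assoc, mul_eq_one_iff_eq_inv.1 e1.symm]
        simp }
  have hK : ∀ g, g ∈ K := have : Nonempty X := ⟨x₀⟩
    h.mem_of_stabilizer_le hsc.1 fun w hw s hs g => by
      rw [hφs w hw g s hs, hφf w hw s hs]
  exact ⟨MonoidHom.mk' φ fun g s => hK s g, hφf⟩

end IsFundamentalDomain

end FundamentalDomain

/-! ### Parabolics acting on residues -/

section Parabolic

variable {X : Type u} {I : Type v} {Γ : Pregeometry X I} {G : Subgroup (Equiv.Perm X)}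
  {W U : Set X}

theorem parabolic_antitone {V : Set X} (h : U ⊆ V) : parabolic G V ≤ parabolic G U :=
  fixingSubgroup_antitone G X h

theorem mem_parabolic {g : G} : g ∈ parabolic G U ↔ ∀ x ∈ U, g • x = x :=
  mem_fixingSubgroup_iff G

theorem mem_parabolic_insert {g : G} {w : X} :
    g ∈ parabolic G (insert w U) ↔ g • w = w ∧ g ∈ parabolic G U := by
  simp [mem_parabolic]

theorem typ_smul (hG : G ≤ Γ.autGroup) (g : G) (x : X) : Γ.typ (g • x) = Γ.typ x :=
  (hG g.2).1 x

theorem inc_smul_iff (hG : G ≤ Γ.autGroup) (g : G) (x y : X) :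
    Γ.inc (g • x) (g • y) ↔ Γ.inc x y :=
  (hG g.2).2 x y

theorem isFlag_union_singleton_iff (hU : Γ.IsFlag U) {x : X} :
    Γ.IsFlag (U ∪ {x}) ↔ ∀ u ∈ U, Γ.inc u x := by
  constructor
  · intro h u hu
    exact h u (Or.inl hu) x (Or.inr rfl)
  · rintro h u (hu | rfl) v (hv | rfl)
    · exact hU u hu v hv
    · exact h u hu
    · exact Γ.inc_symm _ _ (h v hv)
    · exact Γ.inc_refl _

theorem mem_residueElements_iff (hU : Γ.IsFlag U) {x : X} :
    x ∈ Γ.residueElements U ↔ Γ.typ x ∉ Γ.typ '' U ∧ ∀ u ∈ U, Γ.inc u x := by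
  rw [← isFlag_union_singleton_iff hU]
  constructor
  · exact fun h => ⟨h.1.1, h.2⟩
  · exact fun h => ⟨⟨h.1, x, rfl, h.2⟩, h.2⟩

theorem IsGeometry.residueTypes_eq (hΓ : Γ.IsGeometry) (hU : Γ.IsFlag U) :
    Γ.residueTypes U = (Γ.typ '' U)ᶜ := by
  ext j
  refine ⟨fun h => h.1, fun h => ⟨h, ?_⟩⟩
  obtain ⟨C, hC, hUC⟩ := hΓ U hU
  obtain ⟨x, hx, rfl⟩ : j ∈ Γ.typ '' C := hC.2 ▸ Set.mem_univ j
  exact ⟨x, rfl, hC.1.subset (Set.union_subset hUC (by simpa using hx))⟩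

theorem IsGeometry.rank_residue (hΓ : Γ.IsGeometry) (hU : Γ.IsFlag U) :
    (Γ.residue U).rank = (Γ.typ '' U)ᶜ.ncard := by
  rw [← hΓ.residueTypes_eq hU]
  rfl

theorem IsLounge.isFlag_insert (hW : Γ.IsLounge W) (hUW : U ⊆ W) (hU : Γ.IsFlag U) {w : X}
    (hw : w ∈ W) (ht : Γ.typ w ∉ Γ.typ '' U) : Γ.IsFlag (insert w U) := by
  refine hW _ (Set.insert_subset hw hUW) ?_
  rintro x (rfl | hx) y (rfl | hy) h
  · rfl
  · exact (ht ⟨y, hy, h.symm⟩).elim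
  · exact (ht ⟨x, hx, h⟩).elim
  · exact Γ.eq_of_inc _ _ (hU x hx y hy) h

/-- Every flag can be moved into the hall `W`. -/
theorem exists_smul_mem_of_isFlag (hG : G ≤ Γ.autGroup) (hWrep : IsOrbitRepresentatives G W)
    (hW : Γ.IsLounge W)
    (htrans : ∀ V ⊆ W, Γ.IsFlag V → Γ.IsFlagTransitiveOn G (orbitElements G V))
    {F : Set X} (hF : Γ.IsFlag F) : ∃ g : G, ∀ x ∈ F, g • x ∈ W := by
  choose ρ hρ using fun x => (hWrep x).exists
  have htyp : ∀ x, Γ.typ (ρ x) = Γ.typ x := fun x => by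
    obtain ⟨g, hg⟩ := (hρ x).2
    rw [← hg]
    exact typ_smul hG g x
  have hsub : ρ '' F ⊆ W := by
    rintro _ ⟨x, -, rfl⟩
    exact (hρ x).1
  -- As `ρ` preserves types and `typ` is injective on the flag `F`, it is injective on `ρ '' F`, so
  -- the lounge property applies.
  have hflag : Γ.IsFlag (ρ '' F) := by
    refine hW _ hsub ?_
    rintro _ ⟨x, hx, rfl⟩ _ ⟨y, hy, rfl⟩ h
    rw [htyp, htyp] at h
    rw [Γ.eq_of_inc x y (hF x hx y hy) h]
  obtain ⟨σ, hσ, hσF⟩ := htrans _ hsub hflag F (ρ '' F)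
    (fun x hx => Set.mem_biUnion (Set.mem_image_of_mem ρ hx)
      (MulAction.mem_orbit_symm.1 (hρ x).2))
    (fun x hx => Set.mem_biUnion hx (MulAction.mem_orbit_self x)) hF hflag
    (by rw [Set.image_image]; simp only [htyp])
  exact ⟨⟨σ, hσ⟩, fun x hx => hsub (hσF ▸ Set.mem_image_of_mem σ hx)⟩

theorem IsOrbitRepresentatives.smul_eq (hWrep : IsOrbitRepresentatives G W) {w : X} (hw : w ∈ W)
    {g : G} (hg : g • w ∈ W) : g • w = w :=
  (hWrep w).unique ⟨hg, MulAction.mem_orbit w g⟩ ⟨hw, MulAction.mem_orbit_self w⟩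

theorem smul_mem_residueElements (hG : G ≤ Γ.autGroup) (hU : Γ.IsFlag U)
    {g : G} (hg : g ∈ parabolic G U) {x : X} (hx : x ∈ Γ.residueElements U) :
    g • x ∈ Γ.residueElements U := by
  rw [mem_residueElements_iff hU] at hx ⊢
  refine ⟨by rw [typ_smul hG]; exact hx.1, fun u hu => ?_⟩
  rw [← mem_parabolic.1 hg u hu, inc_smul_iff hG]
  exact hx.2 u hu

/-- The action of the parabolic `G_U` on the residue of `U`. -/
abbrev residueAction (hG : G ≤ Γ.autGroup) (hU : Γ.IsFlag U) :
    MulAction (parabolic G U) (Γ.residueElements U) where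
  smul g x := ⟨(g : G) • (x : X), smul_mem_residueElements hG hU g.2 x.2⟩
  one_smul x := Subtype.ext (one_smul G (x : X))
  mul_smul g g' x := Subtype.ext (mul_smul (g : G) (g' : G) (x : X))

/-- An element moving the flag `U ∪ {x, y, z}` into `W` fixes `U` pointwise, because distinct
elements of `W` lie in distinct orbits; so it belongs to `G_U`. -/
theorem isFundamentalDomain_residue (hG : G ≤ Γ.autGroup)
    (hWrep : IsOrbitRepresentatives G W) (hW : Γ.IsLounge W)
    (htrans : ∀ V ⊆ W, Γ.IsFlag V → Γ.IsFlagTransitiveOn G (orbitElements G V))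
    (hUW : U ⊆ W) (hU : Γ.IsFlag U) :
    letI := residueAction hG hU
    (Γ.residue U).IsFundamentalDomain (parabolic G U) (Subtype.val ⁻¹' W) := by
  let := residueAction hG hU
  refine ⟨fun g x y hxy => (inc_smul_iff hG (g : G) x y).2 hxy,
    fun w hw g hg => Subtype.ext (hWrep.smul_eq hw hg), fun x y z hxy hyz hzx => ?_⟩
  have hmem : ∀ t : Γ.residueElements U, ∀ u ∈ U, Γ.inc u t :=
    fun t => ((mem_residueElements_iff hU).1 t.2).2
  have hF : Γ.IsFlag (U ∪ {(x : X), (y : X), (z : X)}) := by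
    have hxy' : Γ.inc x y := hxy
    have hyz' : Γ.inc y z := hyz
    have hzx' : Γ.inc z x := hzx
    have hyx := Γ.inc_symm _ _ hxy'
    have hzy := Γ.inc_symm _ _ hyz'
    have hxz := Γ.inc_symm _ _ hzx'
    have hT : ∀ s ∈ ({(x : X), (y : X), (z : X)} : Set X),
        ∀ t ∈ ({(x : X), (y : X), (z : X)} : Set X), Γ.inc s t := by
      rintro s (rfl | rfl | rfl) t (rfl | rfl | rfl) <;> first | exact Γ.inc_refl _ | assumption
    have hUT : ∀ u ∈ U, ∀ t ∈ ({(x : X), (y : X), (z : X)} : Set X), Γ.inc u t := by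
      rintro u hu t (rfl | rfl | rfl) <;> exact hmem _ u hu
    rintro s (hs | hs) t (ht | ht)
    · exact hU s hs t ht
    · exact hUT s hs t ht
    · exact Γ.inc_symm _ _ (hUT t ht s hs)
    · exact hT s hs t ht
  obtain ⟨g, hg⟩ := exists_smul_mem_of_isFlag hG hWrep hW htrans hF
  have hgU : g ∈ parabolic G U :=
    mem_parabolic.2 fun u hu => hWrep.smul_eq (hUW hu) (hg u (Or.inl hu))
  exact ⟨⟨g, hgU⟩, hg x (by simp), hg y (by simp), hg z (by simp)⟩

/-- A parabolic acting on a connected residue is generated by the next smaller parabolics. -/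
theorem parabolic_le_of_insert (hG : G ≤ Γ.autGroup)
    (hWrep : IsOrbitRepresentatives G W) (hW : Γ.IsLounge W)
    (htrans : ∀ V ⊆ W, Γ.IsFlag V → Γ.IsFlagTransitiveOn G (orbitElements G V))
    (hUW : U ⊆ W) (hU : Γ.IsFlag U) (hconn : (Γ.residue U).IsConnected)
    (hne : (Γ.residueElements U).Nonempty) {K : Subgroup G}
    (hK : ∀ w ∈ W, Γ.typ w ∉ Γ.typ '' U → parabolic G (insert w U) ≤ K) :
    parabolic G U ≤ K := by
  let := residueAction hG hU
  have : Nonempty (Γ.residueElements U) := hne.to_subtype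
  intro g hg
  exact (isFundamentalDomain_residue hG hWrep hW htrans hUW hU).mem_of_stabilizer_le hconn
    (K := K.subgroupOf (parabolic G U))
    (fun w hw s hs => hK w hw w.2.1.1
      (mem_parabolic_insert.2 ⟨congrArg Subtype.val hs, s.2⟩)) ⟨g, hg⟩

/-- Compatible homomorphisms from the next smaller parabolics extend to a parabolic acting on a
simply connected residue. -/
theorem exists_extension_of_insert (hG : G ≤ Γ.autGroup)
    (hWrep : IsOrbitRepresentatives G W) (hW : Γ.IsLounge W)
    (htrans : ∀ V ⊆ W, Γ.IsFlag V → Γ.IsFlagTransitiveOn G (orbitElements G V))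
    (hUW : U ⊆ W) (hU : Γ.IsFlag U) (hsc : (Γ.residue U).IsSimplyConnected)
    (hne : (Γ.residueElements U).Nonempty) {H : Type*} [Group H]
    (f : ∀ w, parabolic G (insert w U) →* H)
    (hf : ∀ w ∈ W, ∀ w' ∈ W, Γ.typ w ∉ Γ.typ '' U → Γ.typ w' ∉ Γ.typ '' U → Γ.inc w w' →
      ∀ s hs hs', f w ⟨s, hs⟩ = f w' ⟨s, hs'⟩) :
    ∃ φ : parabolic G U →* H, ∀ w ∈ W, Γ.typ w ∉ Γ.typ '' U → ∀ s hs hs',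
      φ ⟨s, hs⟩ = f w ⟨s, hs'⟩ := by
  classical
  let := residueAction hG hU
  have : Nonempty (Γ.residueElements U) := hne.to_subtype
  have hmem : ∀ {s : parabolic G U} {w : Γ.residueElements U}, s • w = w →
      (s : G) ∈ parabolic G (insert (w : X) U) := fun {s w} hs =>
    mem_parabolic_insert.2 ⟨congrArg Subtype.val hs, s.2⟩
  obtain ⟨φ, hφ⟩ :=
    (isFundamentalDomain_residue hG hWrep hW htrans hUW hU).exists_extension hsc
    (fun w s => if hs : (s : G) ∈ parabolic G (insert (w : X) U) then f w ⟨s, hs⟩ else 1)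
    (by
      intro w hw s t hs ht
      rw [dif_pos (hmem hs), dif_pos (hmem ht), ← map_mul,
        dif_pos (show ((s * t : parabolic G U) : G) ∈ _ from mul_mem (hmem hs) (hmem ht))]
      rfl)
    (by
      intro w hw w' hw' hww' s hs hs'
      rw [dif_pos (hmem hs), dif_pos (hmem hs')]
      exact hf w hw w' hw' w.2.1.1 w'.2.1.1 hww' s _ _)
  refine ⟨φ, fun w hw ht s hs hs' => ?_⟩
  have hw' : w ∈ Γ.residueElements U := (mem_residueElements_iff hU).2
    ⟨ht, fun u hu => hW.isFlag_insert hUW hU hw ht u (Or.inr hu) w (Or.inl rfl)⟩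
  rw [hφ ⟨w, hw'⟩ hw ⟨s, hs⟩ (Subtype.ext (mem_parabolic_insert.1 hs').1), dif_pos hs']

end Parabolic

/-! ### Induction on the corank and the universal completions -/

section Completion

variable {X : Type u} {I : Type v} {Γ : Pregeometry X I}
  {G : Subgroup (Equiv.Perm X)} {W : Set X} {k : ℕ}

theorem ncard_compl_image_insert_lt [Finite I] {U : Set X} {w : X} (ht : Γ.typ w ∉ Γ.typ '' U) :
    (Γ.typ '' insert w U)ᶜ.ncard < (Γ.typ '' U)ᶜ.ncard := by
  refine Set.ncard_lt_ncard ?_ (Set.toFinite _)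
  rw [Set.image_insert_eq]
  apply compl_lt_compl_iff_lt.2
  exact Set.ssubset_insert ht

/-- A flag of `W` whose parabolic does not belong to the amalgam of rank `k` parabolics has
residue of rank at least `k`, and this residue is nonempty unless there are no elements at all. -/
theorem le_rank_residue_of_notMem (hΓ : Γ.IsGeometry) (hk : k ≤ Nat.card I) {U : Set X}
    (hUW : U ⊆ W) (hU : Γ.IsFlag U) (hUS : U ∉ Γ.nonemptyFlagsOfCorankLE W k) :
    k ≤ (Γ.residue U).rank ∧ (IsEmpty X ∨ (Γ.residueElements U).Nonempty) := by
  rw [hΓ.rank_residue hU]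
  have hne : (Γ.typ '' U)ᶜ.Nonempty → (Γ.residueElements U).Nonempty := by
    rw [← hΓ.residueTypes_eq hU]
    rintro ⟨j, hj⟩
    obtain ⟨x, rfl, hx⟩ := hj.2
    exact ⟨x, hj, hx⟩
  rcases U.eq_empty_or_nonempty with rfl | hU'
  -- The empty flag is excluded from the amalgam even if `k = |I|`, so only a weak inequality is
  -- available here.
  · refine ⟨by simpa [Set.ncard_univ] using hk, ?_⟩
    rcases isEmpty_or_nonempty X with h | ⟨⟨x⟩⟩
    · exact Or.inl h
    · exact Or.inr (hne ⟨Γ.typ x, by simp⟩)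
  · have hlt : k < (Γ.typ '' U)ᶜ.ncard := by
      by_contra! h
      exact hUS ⟨⟨hUW, hU, hU'⟩, h⟩
    exact ⟨hlt.le, Or.inr (hne (Set.nonempty_of_ncard_ne_zero (by omega)))⟩

/-- Induction on the corank: outside the amalgam the residue is connected, so `G_U` is generated by
the parabolics of flags with one more element. -/
theorem parabolic_le_of_nonemptyFlagsOfCorankLE [Finite I] (hΓ : Γ.IsGeometry) (hG : G ≤ Γ.autGroup)
    (hWrep : IsOrbitRepresentatives G W) (hW : Γ.IsLounge W)
    (htrans : ∀ V ⊆ W, Γ.IsFlag V → Γ.IsFlagTransitiveOn G (orbitElements G V))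
    (hk : k ≤ Nat.card I)
    (hsc : ∀ U ⊆ W, Γ.IsFlag U → k ≤ (Γ.residue U).rank → (Γ.residue U).IsSimplyConnected)
    {U : Set X} (hUW : U ⊆ W) (hU : Γ.IsFlag U) {K : Subgroup G}
    (hK : ∀ V ∈ Γ.nonemptyFlagsOfCorankLE W k, U ⊆ V → parabolic G V ≤ K) :
    parabolic G U ≤ K := by
  induction hn : (Γ.typ '' U)ᶜ.ncard using Nat.strong_induction_on generalizing U with
  | _ n ih =>
  subst hn
  by_cases hUS : U ∈ Γ.nonemptyFlagsOfCorankLE W k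
  · exact hK U hUS subset_rfl
  obtain ⟨hr, h | hne⟩ := le_rank_residue_of_notMem hΓ hk hUW hU hUS
  · intro g _
    rw [Subsingleton.elim g 1]
    exact one_mem K
  refine parabolic_le_of_insert hG hWrep hW htrans hUW hU (hsc U hUW hU hr).1 hne
    fun w hw ht => ih _ (ncard_compl_image_insert_lt ht) (Set.insert_subset hw hUW)
      (hW.isFlag_insert hUW hU hw ht) (fun V hV hUV => hK V hV ?_) rfl
  exact (Set.subset_insert w U).trans hUV

/-- Compatible homomorphisms from the rank `k` parabolics extend to all parabolics. -/
theorem exists_extension_parabolic [Finite I] (hΓ : Γ.IsGeometry) (hG : G ≤ Γ.autGroup)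
    (hWrep : IsOrbitRepresentatives G W) (hW : Γ.IsLounge W)
    (htrans : ∀ V ⊆ W, Γ.IsFlag V → Γ.IsFlagTransitiveOn G (orbitElements G V))
    (hk : k ≤ Nat.card I)
    (hsc : ∀ U ⊆ W, Γ.IsFlag U → k ≤ (Γ.residue U).rank → (Γ.residue U).IsSimplyConnected)
    {H : Type*} [Group H] (π : ∀ V : Γ.nonemptyFlagsOfCorankLE W k, parabolic G (V : Set X) →* H)
    (hπ : ∀ V V' : Γ.nonemptyFlagsOfCorankLE W k, (V' : Set X) ⊆ V → ∀ s hs hs',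
      π V ⟨s, hs⟩ = π V' ⟨s, hs'⟩)
    {U : Set X} (hUW : U ⊆ W) (hU : Γ.IsFlag U) :
    ∃ φ : parabolic G U →* H, ∀ V : Γ.nonemptyFlagsOfCorankLE W k, U ⊆ V → ∀ s hs hs',
      φ ⟨s, hs⟩ = π V ⟨s, hs'⟩ := by
  induction hn : (Γ.typ '' U)ᶜ.ncard using Nat.strong_induction_on generalizing U with
  | _ n ih =>
  subst hn
  by_cases hUS : U ∈ Γ.nonemptyFlagsOfCorankLE W k
  · exact ⟨π ⟨U, hUS⟩, fun V hUV s hs hs' => (hπ V ⟨U, hUS⟩ hUV s hs' hs).symm⟩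
  obtain ⟨hr, h | hne⟩ := le_rank_residue_of_notMem hΓ hk hUW hU hUS
  · exact ⟨1, fun V => (h.false V.2.1.2.2.some).elim⟩
  have hφ : ∀ w, ∃ φ : parabolic G (insert w U) →* H, w ∈ W → Γ.typ w ∉ Γ.typ '' U →
      ∀ V : Γ.nonemptyFlagsOfCorankLE W k, insert w U ⊆ V → ∀ s hs hs',
      φ ⟨s, hs⟩ = π V ⟨s, hs'⟩ := by
    intro w
    by_cases hw : w ∈ W ∧ Γ.typ w ∉ Γ.typ '' U
    · obtain ⟨φ, hφ⟩ := ih _ (ncard_compl_image_insert_lt hw.2) (Set.insert_subset hw.1 hUW)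
        (hW.isFlag_insert hUW hU hw.1 hw.2) rfl
      exact ⟨φ, fun _ _ => hφ⟩
    · exact ⟨1, fun h1 h2 => (hw ⟨h1, h2⟩).elim⟩
  choose f hf using hφ
  obtain ⟨φ, hφ⟩ := exists_extension_of_insert hG hWrep hW htrans hUW hU (hsc U hUW hU hr) hne f (by
    -- The overlap `G_{U ∪ {w, w'}}` may lie outside the amalgam itself, so agreement there has to
    -- come from generation.
    intro w hw w' hw' ht ht' hww' s hs hs'
    have hflag : Γ.IsFlag (insert w (insert w' U)) := by
      have h1 := hW.isFlag_insert hUW hU hw ht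
      have h2 := hW.isFlag_insert hUW hU hw' ht'
      rintro x (rfl | hx) y (rfl | hy)
      · exact Γ.inc_refl _
      · rcases hy with rfl | hy
        · exact hww'
        · exact h1 _ (Or.inl rfl) y (Or.inr hy)
      · rcases hx with rfl | hx
        · exact Γ.inc_symm _ _ hww'
        · exact h1 x (Or.inr hx) _ (Or.inl rfl)
      · exact h2 x hx y hy
    have hle : insert w U ⊆ insert w (insert w' U) :=
      Set.insert_subset_insert (Set.subset_insert _ _)
    have hle' : insert w' U ⊆ insert w (insert w' U) := Set.subset_insert _ _
    -- the two homomorphisms agree on a subgroup containing all smaller parabolics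
    have hP := parabolic_le_of_nonemptyFlagsOfCorankLE hΓ hG hWrep hW htrans hk hsc
      (Set.insert_subset hw (Set.insert_subset hw' hUW)) hflag
      (K := (((f w).comp (Subgroup.inclusion (parabolic_antitone hle))).eqLocus
        ((f w').comp (Subgroup.inclusion (parabolic_antitone hle')))).map
        (parabolic G (insert w (insert w' U))).subtype) (by
        intro V hV hUV s hs
        have hs0 := parabolic_antitone hUV hs
        refine ⟨⟨s, hs0⟩, ?_, rfl⟩
        exact (hf w hw ht ⟨V, hV⟩ (hle.trans hUV) s _ hs).trans
          (hf w' hw' ht' ⟨V, hV⟩ (hle'.trans hUV) s _ hs).symm)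
    obtain ⟨t, ht, rfl⟩ := hP (mem_parabolic_insert.2 ⟨(mem_parabolic_insert.1 hs).1, hs'⟩)
    exact ht)
  refine ⟨φ, fun V hUV s hs hs' => ?_⟩
  -- `U` is not in the amalgam, so `V` is strictly larger and `G_V` lies in some `G_{U ∪ {w}}`.
  obtain ⟨w, hw, hwU⟩ : ∃ w ∈ (V : Set X), w ∉ U := by
    by_contra! h
    exact hUS (Set.Subset.antisymm hUV h ▸ V.2)
  have ht : Γ.typ w ∉ Γ.typ '' U := by
    rintro ⟨u, hu, hut⟩
    exact hwU (Γ.eq_of_inc u w (V.2.1.2.1 u (hUV hu) w hw) hut ▸ hu)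
  have hins : insert w U ⊆ (V : Set X) := Set.insert_subset hw hUV
  exact (hφ w (V.2.1.1 hw) ht s hs (parabolic_antitone hins hs')).trans
    (hf w (V.2.1.1 hw) ht V hins s _ hs')

theorem shapeToGroup_toUniversal (S : Set (Set X)) (V : S) (s : parabolic G (V : Set X)) :
    shapeToGroup G S ((shapeAmalgam G S).toUniversal V s) = s :=
  Amalgam.lift_toUniversal (shapeAmalgam G S)
    (fun U : S => (parabolic G (U : Set X)).subtype) (fun _ _ _ _ => rfl) V s

/-- Extending the universal maps to `G_∅ = G` yields a left inverse; surjectivity is generation by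
the rank `k` parabolics. -/
theorem bijective_shapeToGroup [Finite I] (hΓ : Γ.IsGeometry) (hG : G ≤ Γ.autGroup)
    (hWrep : IsOrbitRepresentatives G W) (hW : Γ.IsLounge W)
    (htrans : ∀ V ⊆ W, Γ.IsFlag V → Γ.IsFlagTransitiveOn G (orbitElements G V))
    (hk : k ≤ Nat.card I)
    (hsc : ∀ U ⊆ W, Γ.IsFlag U → k ≤ (Γ.residue U).rank → (Γ.residue U).IsSimplyConnected) :
    Function.Bijective (shapeToGroup G (Γ.nonemptyFlagsOfCorankLE W k)) := by
  set S := Γ.nonemptyFlagsOfCorankLE W k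
  have hempty : Γ.IsFlag ∅ := fun x hx => hx.elim
  have htop : ∀ g, g ∈ parabolic G (∅ : Set X) := fun g => mem_parabolic.2 (by simp)
  constructor
  · obtain ⟨φ, hφ⟩ := exists_extension_parabolic hΓ hG hWrep hW htrans hk hsc
      (fun V : S => (shapeAmalgam G S).toUniversal V)
      (fun V V' hV s hs hs' =>
        ((shapeAmalgam G S).toUniversal_compatible V V' hV ⟨s, hs⟩).symm)
      (Set.empty_subset W) hempty
    let ψ : G →* (shapeAmalgam G S).UniversalCompletion :=
      φ.comp ((MonoidHom.id G).codRestrict _ htop)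
    have hψ : ψ.comp (shapeToGroup G S) = MonoidHom.id _ := by
      refine PresentedGroup.ext fun x => ?_
      obtain ⟨V, s⟩ := x
      have := shapeToGroup_toUniversal S V s
      change ψ (shapeToGroup G S ((shapeAmalgam G S).toUniversal V s)) =
        (shapeAmalgam G S).toUniversal V s
      rw [this]
      exact hφ V (Set.empty_subset _) s.1 _ s.2
    exact Function.LeftInverse.injective (g := ψ) fun x => DFunLike.congr_fun hψ x
  · rw [← MonoidHom.range_eq_top, eq_top_iff]
    intro g _
    refine parabolic_le_of_nonemptyFlagsOfCorankLE hΓ hG hWrep hW htrans hk hsc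
      (Set.empty_subset W) hempty (fun V hV _ s hs => ?_) (htop g)
    exact ⟨(shapeAmalgam G S).toUniversal ⟨V, hV⟩ ⟨s, hs⟩, shapeToGroup_toUniversal S ⟨V, hV⟩ _⟩

theorem shapeToGroup_comp_shapeMap {S T : Set (Set X)} (h : S ⊆ T) :
    (shapeToGroup G T).comp (shapeMap G h) = shapeToGroup G S := by
  refine PresentedGroup.ext fun x => ?_
  obtain ⟨V, s⟩ := x
  simp only [MonoidHom.comp_apply]
  have e : shapeMap G h (PresentedGroup.of ⟨V, s⟩) =
      (shapeAmalgam G T).toUniversal ⟨V.1, h V.2⟩ s :=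
    Amalgam.lift_toUniversal _ _ _ V s
  rw [e]
  exact (shapeToGroup_toUniversal T ⟨V.1, h V.2⟩ s).trans (shapeToGroup_toUniversal S V s).symm

theorem nonemptyFlagsOfCorankLE_card [Finite I] (W : Set X) :
    Γ.nonemptyFlagsOfCorankLE W (Nat.card I) = Γ.nonemptyFlags W :=
  Set.Subset.antisymm (Γ.nonemptyFlagsOfCorankLE_subset W _) fun U hU =>
    ⟨hU, by simpa [Set.ncard_univ] using Set.ncard_le_ncard (Set.subset_univ (Γ.typ '' U)ᶜ)⟩

end Completion

end Pregeometry

theorem corollary3p4 {X : Type u} {I : Type v} [Finite I] (Γ : Pregeometry X I)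
    (hΓ : Γ.IsGeometry)
    (G : Subgroup (Equiv.Perm X)) (hG : G ≤ Γ.autGroup)
    (W : Set X) (hWfin : W.Finite)
    (hWrep : Pregeometry.IsOrbitRepresentatives G W)
    (hWhall : Γ.IsHall W)
    (htrans : ∀ V ⊆ W, Γ.IsFlag V →
      Γ.IsFlagTransitiveOn G (Pregeometry.orbitElements G V))
    (k : ℕ) (hk : k ≤ Nat.card I)
    (hsc : ∀ U ⊆ W, Γ.IsFlag U → k ≤ (Γ.residue U).rank → (Γ.residue U).IsSimplyConnected) :
    Function.Bijective (Pregeometry.shapeToGroup G (Γ.nonemptyFlags W)) ∧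
    Function.Bijective (Pregeometry.shapeToGroup G (Γ.nonemptyFlagsOfCorankLE W k)) ∧
    Function.Bijective
      (Pregeometry.shapeMap G (Γ.nonemptyFlagsOfCorankLE_subset W k)) := by
  have hT := Pregeometry.bijective_shapeToGroup hΓ hG hWrep hWhall.1 htrans le_rfl
    fun U hUW hU hr => hsc U hUW hU (hk.trans hr)
  rw [Pregeometry.nonemptyFlagsOfCorankLE_card] at hT
  have hS := Pregeometry.bijective_shapeToGroup hΓ hG hWrep hWhall.1 htrans hk hsc
  refine ⟨hT, hS, ?_⟩
  -- Two out of three: composing with the bijection `hT` gives the map of `hS`.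
  rw [← Function.Bijective.of_comp_iff' hT, ← MonoidHom.coe_comp,
    Pregeometry.shapeToGroup_comp_shapeMap]
  exact hS
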